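/- Let $G$ be a finite group of order $n$, let $\pi$ be a set (possibly empty) of prime divisors of $n$, and let $\pi'$ be the set of all primes not in $\pi$. For a set of primes $\sigma$, a $\sigma$-number is a positive integer all of whose prime divisors lie in $\sigma$. Every element $x$ of a finite group $K$ can be written uniquely as $x = x_\sigma x_{\sigma'}$, where $x_\sigma, x_{\sigma'} \in K$ commute, the order $o(x_\sigma)$ is a $\sigma$-number and $o(x_{\sigma'})$ is a $\sigma'$-number, $\sigma'$ being the set of primes not in $\sigma$. Put $$\psi_\sigma(K) = \sum_{x \in K} o(x_\sigma).$$ Let $C_n$ be the cyclic group of order $n$. If $\psi_\pi(G) = \psi_\pi(C_n)$ and $\psi_{\pi'}(G) = \psi_{\pi'}(C_n)$, then $G \cong C_n$. -/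

import Mathlib

/-- A `π`-number: a positive integer all of whose prime divisors lie in `π`. -/
def IsPiNumber (π : Set ℕ) (m : ℕ) : Prop :=
  m ≠ 0 ∧ ∀ p : ℕ, p.Prime → p ∣ m → p ∈ π

/-- The set `π'` of all primes that are not in `π`. -/
def piCompl (π : Set ℕ) : Set ℕ := {p | p.Prime ∧ p ∉ π}

theorem IsPiNumber.mul {π : Set ℕ} {a b : ℕ} (ha : IsPiNumber π a) (hb : IsPiNumber π b) :
    IsPiNumber π (a * b) :=
  ⟨mul_ne_zero ha.1 hb.1, fun p hp h => (hp.dvd_mul.1 h).elim (ha.2 p hp) (hb.2 p hp)⟩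

theorem IsPiNumber.of_dvd {π : Set ℕ} {a b : ℕ} (hb : IsPiNumber π b) (h : a ∣ b) :
    IsPiNumber π a :=
  ⟨fun h0 => hb.1 (by simpa [h0] using h), fun p hp hpa => hb.2 p hp (hpa.trans h)⟩

theorem IsPiNumber.coprime {π : Set ℕ} {a b : ℕ} (ha : IsPiNumber π a)
    (hb : IsPiNumber (piCompl π) b) : Nat.Coprime a b :=
  Nat.coprime_of_dvd fun p hp hpa hpb => (hb.2 p hp hpb).2 (ha.2 p hp hpa)

theorem exists_piNumber_mul (π : Set ℕ) (k : ℕ) (hk : k ≠ 0) :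
    ∃ a b : ℕ, a * b = k ∧ IsPiNumber π a ∧ IsPiNumber (piCompl π) b := by
  have h1 : ∀ σ : Set ℕ, IsPiNumber σ 1 := fun σ =>
    ⟨one_ne_zero, fun p hp h => absurd (Nat.dvd_one.1 h) hp.ne_one⟩
  have hprime : ∀ (σ : Set ℕ) (p : ℕ), p.Prime → p ∈ σ → IsPiNumber σ p := fun σ p hp hpσ =>
    ⟨hp.ne_zero, fun q hq h => by rwa [(Nat.prime_dvd_prime_iff_eq hq hp).1 h]⟩
  induction k using induction_on_primes with
  | zero => exact absurd rfl hk
  | one => exact ⟨1, 1, rfl, h1 _, h1 _⟩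
  | prime_mul p k hp ih =>
    obtain ⟨a, b, hab, ha, hb⟩ := ih (right_ne_zero_of_mul hk)
    by_cases hpπ : p ∈ π
    · exact ⟨p * a, b, by rw [mul_assoc, hab], (hprime _ p hp hpπ).mul ha, hb⟩
    · exact ⟨a, p * b, by rw [mul_left_comm, hab], ha, (hprime (piCompl π) p hp ⟨hp, hpπ⟩).mul hb⟩

/-- `y` and `z` are the `π`-part and the `π'`-part of `x`: they commute, `x = y z`, the order of
`y` is a `π`-number and the order of `z` is a `π'`-number. -/
def IsPiDecomposition {G : Type*} [Group G] (π : Set ℕ) (x y z : G) : Prop :=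
  x = y * z ∧ Commute y z ∧ IsPiNumber π (orderOf y) ∧ IsPiNumber (piCompl π) (orderOf z)

theorem exists_isPiDecomposition {G : Type*} [Group G] [Finite G] (π : Set ℕ) (x : G) :
    ∃ y z : G, IsPiDecomposition π x y z := by
  obtain ⟨a, b, hab, ha, hb⟩ := exists_piNumber_mul π (orderOf x) (orderOf_pos x).ne'
  obtain ⟨u, hu0, hu1⟩ := Nat.chineseRemainder (ha.coprime hb) 1 0
  obtain ⟨v, hv0, hv1⟩ := Nat.chineseRemainder (ha.coprime hb) 0 1
  refine ⟨x ^ u, x ^ v, ?_, (Commute.refl x).pow_pow u v, ha.of_dvd ?_, hb.of_dvd ?_⟩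
  · rw [← pow_add]
    have h : u + v ≡ 1 [MOD orderOf x] := by
      rw [← hab, ← Nat.modEq_and_modEq_iff_modEq_mul (ha.coprime hb)]
      exact ⟨hu0.add hv0, hu1.add hv1⟩
    simpa using (pow_eq_pow_iff_modEq.2 h).symm
  · apply orderOf_dvd_of_pow_eq_one
    rw [← pow_mul, ← orderOf_dvd_iff_pow_eq_one, ← hab, mul_comm a b]
    exact mul_dvd_mul_right ((Nat.modEq_zero_iff_dvd).1 hu1) a
  · apply orderOf_dvd_of_pow_eq_one
    rw [← pow_mul, ← orderOf_dvd_iff_pow_eq_one, ← hab]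
    exact mul_dvd_mul_right ((Nat.modEq_zero_iff_dvd).1 hv0) b

theorem IsPiDecomposition.unique {G : Type*} [Group G] {π : Set ℕ} {x y z y' z' : G}
    (h : IsPiDecomposition π x y z) (h' : IsPiDecomposition π x y' z') : y = y' ∧ z = z' := by
  obtain ⟨hx, hc, hy, hz⟩ := h
  obtain ⟨hx', hc', hy', hz'⟩ := h'
  obtain ⟨t, ht1, ht0⟩ := Nat.chineseRemainder ((hy.mul hy').coprime (hz.mul hz')) 1 0
  have key : ∀ {v w : G}, x = v * w → Commute v w → orderOf v ∣ orderOf y * orderOf y' →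
      orderOf w ∣ orderOf z * orderOf z' → x ^ t = v := by
    intro v w hvw hcomm hv hw
    have e1 : v ^ t = v := by simpa using pow_eq_pow_iff_modEq.2 (ht1.of_dvd hv)
    have e2 : w ^ t = 1 := by simpa using pow_eq_pow_iff_modEq.2 (ht0.of_dvd hw)
    rw [hvw, hcomm.mul_pow, e1, e2, mul_one]
  have e : y = y' := (key hx hc (dvd_mul_right _ _) (dvd_mul_right _ _)).symm.trans
    (key hx' hc' (dvd_mul_left _ _) (dvd_mul_left _ _))
  refine ⟨e, ?_⟩
  subst e
  exact mul_left_cancel (hx.symm.trans hx')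

/-- The `π`-part `x_π` of an element `x` of a finite group. -/
noncomputable def piPart {G : Type*} [Group G] [Finite G] (π : Set ℕ) (x : G) : G :=
  (exists_isPiDecomposition π x).choose

/-- `x = x_π z` for some `z` commuting with `x_π`, of `π'`-order; by uniqueness of the
decomposition this characterizes `x_π`. -/
theorem piPart_spec {G : Type*} [Group G] [Finite G] (π : Set ℕ) (x : G) :
    ∃ z : G, IsPiDecomposition π x (piPart π x) z :=
  (exists_isPiDecomposition π x).choose_spec

/-- `ψ_π(G) = ∑_{x ∈ G} o(x_π)`. -/
noncomputable def psi (π : Set ℕ) (G : Type*) [Group G] [Fintype G] : ℕ :=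
  ∑ x : G, orderOf (piPart π x)

/-!
Write `ψ_σ` for a finite set `σ` of primes. On a cyclic group of order `n` it equals `n ·
M_σ(n)`, where `M_σ(n)` is a product of local factors, one for each `p ∈ σ`, and `n · M_σ(n)`
bounds `ψ_σ(G)` for every group `G` of order `n`. The bound is proved by adding the primes `p`
of `σ` one at a time.

If a Sylow `p`-subgroup `P` is not cyclic, every `p`-part has order at most `|P| / p`, which is
less than the local factor of the cyclic group. If `P` is cyclic, group the elements `x`
according to their `p`-part `y`. For `y ≠ 1`, the element `y` is central in `C(y)` and lies in its
Sylow subgroup, so by transfer `C(y)` has a normal `p`-complement `K`, and the fibre over `y` lies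
in `y K`; the bound for `K` controls its contribution by `|C(y)|`. What remains is a sum over
`p`-elements `y` of `(o(y) - 1) |C(y)|`, and `|C(y)|` is at most the number of `g` with
`g⁻¹ y g ∈ P`; weighting that number by `o(y) - 1` and summing over `y` gives
`|G| ∑_{u ∈ P} (o(u) - 1)`.

For a generator `u` of `P` that last estimate is strict unless `N(P) = C(P)`. So when `ψ_σ(G)`
has the cyclic value, each `P` with `p ∈ σ` is cyclic and central in its normalizer. If this
holds for all primes dividing `|G|`, transfer shows that the commutator subgroup has order prime
to each of them, and `G` is abelian with cyclic Sylow subgroups.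
-/

open Finset

section PrimePart

/-- The `σ`-part of a natural number, for a finite set `σ` of primes. Elements of `σ` that are not
prime contribute a factor `1`, because `Nat.factorization` vanishes there. -/
def primePart (σ : Finset ℕ) (m : ℕ) : ℕ := ∏ p ∈ σ, p ^ m.factorization p

theorem primePart_insert {p : ℕ} {τ : Finset ℕ} (hp : p ∉ τ) (m : ℕ) :
    primePart (insert p τ) m = p ^ m.factorization p * primePart τ m :=
  prod_insert hp

theorem primePart_mul (σ : Finset ℕ) {a b : ℕ} (ha : a ≠ 0) (hb : b ≠ 0) :
    primePart σ (a * b) = primePart σ a * primePart σ b := by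
  simp [primePart, Nat.factorization_mul ha hb, pow_add, prod_mul_distrib]

theorem primePart_eq_one {σ : Finset ℕ} {m : ℕ} (h : ∀ p ∈ σ, p.Prime → ¬ p ∣ m) :
    primePart σ m = 1 := by
  refine prod_eq_one fun p hp => ?_
  by_cases hpp : p.Prime
  · rw [Nat.factorization_eq_zero_of_not_dvd (h p hp hpp), pow_zero]
  · rw [Nat.factorization_eq_zero_of_not_prime _ hpp, pow_zero]

theorem primePart_eq_self {σ : Finset ℕ} {m : ℕ} (hm : m ≠ 0) (h : m.primeFactors ⊆ σ) :
    primePart σ m = m := by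
  rw [primePart, ← prod_subset h]
  · exact Nat.prod_factorization_pow_eq_self hm
  · intro p _ hp
    rw [← Nat.support_factorization, Finsupp.notMem_support_iff] at hp
    rw [hp, pow_zero]

theorem primePart_prime_pow (σ : Finset ℕ) {p : ℕ} (hp : p.Prime) (i : ℕ) :
    primePart σ (p ^ i) = if p ∈ σ then p ^ i else 1 := by
  simp [primePart, hp.factorization_pow, Finsupp.single_apply, pow_ite]

end PrimePart

section MeanOrder

variable {p : ℕ}

/-- The mean order of an element of the cyclic group of order `p ^ a`, for a prime `p`: that group
has `φ(p ^ i)` elements of order `p ^ i` for each `i ≤ a`. -/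
def meanOrder (p a : ℕ) : ℚ := (∑ i ∈ range (a + 1), (p ^ i).totient * (p : ℚ) ^ i) / (p : ℚ) ^ a

theorem meanOrder_zero (p : ℕ) : meanOrder p 0 = 1 := by simp [meanOrder]

theorem pow_mul_meanOrder (hp : p ≠ 0) (a : ℕ) :
    (p : ℚ) ^ a * meanOrder p a = ∑ i ∈ range (a + 1), (p ^ i).totient * (p : ℚ) ^ i :=
  mul_div_cancel₀ _ (pow_ne_zero a (Nat.cast_ne_zero.2 hp))

theorem meanOrder_succ (hp : p.Prime) (a : ℕ) :
    meanOrder p (a + 1) = meanOrder p a / p + (p : ℚ) ^ a * (p - 1) := by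
  have hp0 : (p : ℚ) ≠ 0 := Nat.cast_ne_zero.2 hp.ne_zero
  rw [meanOrder, sum_range_succ, meanOrder, Nat.totient_prime_pow_succ hp, Nat.cast_mul,
    Nat.cast_sub hp.one_le]
  push_cast
  field

theorem meanOrder_pos (hp : p.Prime) (a : ℕ) : 0 < meanOrder p a := by
  have hp0 : (0 : ℚ) < p := Nat.cast_pos.2 hp.pos
  refine div_pos (sum_pos (fun i _ => mul_pos ?_ (pow_pos hp0 i)) ⟨0, by simp⟩) (pow_pos hp0 a)
  exact Nat.cast_pos.2 (Nat.totient_pos.2 (pow_pos hp.pos i))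

theorem pow_lt_meanOrder_succ (hp : p.Prime) (a : ℕ) : (p : ℚ) ^ a < meanOrder p (a + 1) := by
  have hp2 : (2 : ℚ) ≤ p := Nat.ofNat_le_cast.2 hp.two_le
  have hdiv : 0 < meanOrder p a / p := div_pos (meanOrder_pos hp a) (by linarith)
  have hpow : (p : ℚ) ^ a ≤ (p : ℚ) ^ a * (p - 1) :=
    le_mul_of_one_le_right (by positivity) (by linarith)
  rw [meanOrder_succ hp]
  linarith

theorem meanOrder_le_pow (hp : p.Prime) (a : ℕ) : meanOrder p a ≤ (p : ℚ) ^ a := by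
  have hp1 : (1 : ℚ) ≤ p := Nat.one_le_cast.2 hp.one_le
  induction a with
  | zero => simp [meanOrder_zero]
  | succ a ih =>
    have hdiv : meanOrder p a / p ≤ (p : ℚ) ^ a :=
      (div_le_self (meanOrder_pos hp a).le hp1).trans ih
    rw [meanOrder_succ hp, pow_succ]
    linarith

theorem meanOrder_mono (hp : p.Prime) : Monotone (meanOrder p) :=
  monotone_nat_of_le_succ fun a =>
    (meanOrder_le_pow hp a).trans (pow_lt_meanOrder_succ hp a).le

end MeanOrder

section MeanPrimePart

/-- The mean of `primePart σ` over the orders of the elements of a cyclic group of order `n`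
(see `psi_of_isCyclic`). -/
def meanPrimePart (σ : Finset ℕ) (n : ℕ) : ℚ := ∏ p ∈ σ, meanOrder p (n.factorization p)

theorem meanPrimePart_insert {p : ℕ} {τ : Finset ℕ} (hp : p ∉ τ) (n : ℕ) :
    meanPrimePart (insert p τ) n = meanOrder p (n.factorization p) * meanPrimePart τ n :=
  prod_insert hp

theorem meanOrder_factorization_pos (p n : ℕ) : 0 < meanOrder p (n.factorization p) := by
  by_cases hp : p.Prime
  · exact meanOrder_pos hp _
  · simp [Nat.factorization_eq_zero_of_not_prime _ hp, meanOrder_zero]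

theorem meanPrimePart_pos (σ : Finset ℕ) (n : ℕ) : 0 < meanPrimePart σ n :=
  prod_pos fun p _ => meanOrder_factorization_pos p n

theorem meanPrimePart_le_of_dvd (σ : Finset ℕ) {k n : ℕ} (hn : n ≠ 0) (h : k ∣ n) :
    meanPrimePart σ k ≤ meanPrimePart σ n := by
  refine prod_le_prod (fun p _ => (meanOrder_factorization_pos p k).le) fun p _ => ?_
  by_cases hp : p.Prime
  · exact meanOrder_mono hp
      ((Nat.factorization_le_iff_dvd (ne_zero_of_dvd_ne_zero hn h) hn).2 h p)
  · simp [Nat.factorization_eq_zero_of_not_prime _ hp]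

theorem meanPrimePart_mul_of_coprime (σ : Finset ℕ) {a b : ℕ} (h : a.Coprime b) :
    meanPrimePart σ (a * b) = meanPrimePart σ a * meanPrimePart σ b := by
  rw [meanPrimePart, meanPrimePart, meanPrimePart, ← prod_mul_distrib]
  refine prod_congr rfl fun p _ => ?_
  rw [Nat.factorization_mul_of_coprime h, Finsupp.add_apply]
  by_cases hpa : p ∣ a
  · have hpb : b.factorization p = 0 := by
      by_cases hp : p.Prime
      · exact Nat.factorization_eq_zero_of_not_dvd fun hpb =>
          Nat.not_coprime_of_dvd_of_dvd hp.one_lt hpa hpb h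
      · exact Nat.factorization_eq_zero_of_not_prime _ hp
    rw [hpb, add_zero, meanOrder_zero, mul_one]
  · rw [Nat.factorization_eq_zero_of_not_dvd hpa, zero_add, meanOrder_zero, one_mul]

theorem sum_totient_mul_primePart_prime_pow (σ : Finset ℕ) {p : ℕ} (hp : p.Prime) (a : ℕ) :
    ∑ d ∈ (p ^ a).divisors, (d.totient : ℚ) * primePart σ d =
      (p : ℚ) ^ a * meanPrimePart σ (p ^ a) := by
  have hmean : meanPrimePart σ (p ^ a) = if p ∈ σ then meanOrder p a else 1 := by
    simp [meanPrimePart, hp.factorization_pow, Finsupp.single_apply,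
      apply_ite (meanOrder _), meanOrder_zero]
  rw [hmean]
  split_ifs with hpσ
  · rw [Nat.sum_divisors_prime_pow hp, pow_mul_meanOrder hp.ne_zero]
    simp [primePart_prime_pow σ hp, hpσ]
  · have hpart : ∀ d ∈ (p ^ a).divisors, (d.totient : ℚ) * primePart σ d = d.totient := by
      intro d hd
      obtain ⟨i, -, rfl⟩ := (Nat.mem_divisors_prime_pow hp a).1 hd
      simp [primePart_prime_pow σ hp, hpσ]
    rw [sum_congr rfl hpart, mul_one]
    exact_mod_cast Nat.sum_totient (p ^ a)

open ArithmeticFunction ArithmeticFunction.zeta in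
theorem sum_totient_mul_primePart (σ : Finset ℕ) (n : ℕ) :
    ∑ d ∈ n.divisors, (d.totient : ℚ) * primePart σ d = n * meanPrimePart σ n := by
  let f : ArithmeticFunction ℚ := ⟨fun d => d.totient * primePart σ d, by simp⟩
  let g : ArithmeticFunction ℚ := ⟨fun m => m * meanPrimePart σ m, by simp⟩
  have hf : f.IsMultiplicative := by
    refine IsMultiplicative.iff_ne_zero.2 ⟨by simp [f, primePart], fun {a b} ha hb hab => ?_⟩
    simp only [f, ArithmeticFunction.coe_mk, Nat.totient_mul hab, primePart_mul σ ha hb]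
    push_cast
    ring
  have hg : g.IsMultiplicative := by
    refine IsMultiplicative.iff_ne_zero.2
      ⟨by simp [g, meanPrimePart, meanOrder_zero], fun {a b} _ _ hab => ?_⟩
    simp only [g, ArithmeticFunction.coe_mk, meanPrimePart_mul_of_coprime σ hab]
    push_cast
    ring
  have hfg : f * (ζ : ArithmeticFunction ℚ) = g := by
    refine ((hf.mul isMultiplicative_zeta.natCast).eq_iff_eq_on_prime_powers _ _ hg).2
      fun p a hp => ?_
    rw [coe_mul_zeta_apply]
    simpa [f, g] using sum_totient_mul_primePart_prime_pow σ hp a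
  exact (coe_mul_zeta_apply (f := f) (x := n)).symm.trans (congrArg (· n) hfg)

end MeanPrimePart

section PiPart

variable {G : Type*} [Group G]

theorem IsPiDecomposition.orderOf_eq_mul {π : Set ℕ} {x y z : G}
    (h : IsPiDecomposition π x y z) : orderOf x = orderOf y * orderOf z := by
  obtain ⟨rfl, hcomm, hy, hz⟩ := h
  exact hcomm.orderOf_mul_eq_mul_orderOf_of_coprime (hy.coprime hz)

variable [Finite G]

theorem piPart_congr {π ρ : Set ℕ} (h : ∀ p, p.Prime → p ∣ Nat.card G → (p ∈ π ↔ p ∈ ρ)) (x : G) :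
    piPart π x = piPart ρ x := by
  obtain ⟨z, hx, hcomm, hy, hz⟩ := piPart_spec π x
  obtain ⟨z', hx'⟩ := piPart_spec ρ x
  have hyρ : IsPiNumber ρ (orderOf (piPart π x)) := ⟨hy.1, fun p hp hpy =>
    (h p hp (hpy.trans (orderOf_dvd_natCard _))).1 (hy.2 p hp hpy)⟩
  have hzρ : IsPiNumber (piCompl ρ) (orderOf z) := ⟨hz.1, fun p hp hpz =>
    ⟨hp, fun hpρ => (hz.2 p hp hpz).2 ((h p hp (hpz.trans (orderOf_dvd_natCard z))).2 hpρ)⟩⟩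
  exact (IsPiDecomposition.unique ⟨hx, hcomm, hyρ, hzρ⟩ hx').1

theorem orderOf_piPart_coe (σ : Finset ℕ) (x : G) :
    orderOf (piPart (σ : Set ℕ) x) = primePart σ (orderOf x) := by
  obtain ⟨z, hz⟩ := piPart_spec (σ : Set ℕ) x
  have hpart : primePart σ (orderOf (piPart (σ : Set ℕ) x)) = orderOf (piPart (σ : Set ℕ) x) :=
    primePart_eq_self (orderOf_pos _).ne' fun p hp =>
      hz.2.2.1.2 p (Nat.prime_of_mem_primeFactors hp) (Nat.dvd_of_mem_primeFactors hp)
  have hcompl : primePart σ (orderOf z) = 1 :=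
    primePart_eq_one fun p hp hpp hpz => (hz.2.2.2.2 p hpp hpz).2 hp
  rw [hz.orderOf_eq_mul, primePart_mul σ (orderOf_pos _).ne' (orderOf_pos z).ne', hpart, hcompl,
    mul_one]

theorem orderOf_piPart_singleton (p : ℕ) (x : G) :
    orderOf (piPart {p} x) = p ^ (orderOf x).factorization p := by
  rw [← coe_singleton, orderOf_piPart_coe, primePart, prod_singleton]

theorem isPGroup_zpowers_piPart (p : ℕ) (x : G) : IsPGroup p (Subgroup.zpowers (piPart {p} x)) :=
  IsPGroup.of_card (by rw [Nat.card_zpowers, orderOf_piPart_singleton])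

theorem factorization_orderOf_le (p : ℕ) (x : G) :
    (orderOf x).factorization p ≤ (Nat.card G).factorization p :=
  (Nat.factorization_le_iff_dvd (orderOf_pos x).ne' Nat.card_pos.ne').2 (orderOf_dvd_natCard x) p

theorem isCyclic_sylow_of_factorization_orderOf_eq {p : ℕ} [Fact p.Prime] (P : Sylow p G) {x : G}
    (hx : (orderOf x).factorization p = (Nat.card G).factorization p) : IsCyclic P := by
  let Q : Sylow p G := Sylow.ofCard (Subgroup.zpowers (piPart {p} x))
    (by rw [Nat.card_zpowers, orderOf_piPart_singleton, hx])
  have : IsCyclic Q := inferInstanceAs (IsCyclic (Subgroup.zpowers (piPart {p} x)))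
  exact isCyclic_of_surjective _ (Q.equiv P).surjective

end PiPart

section Psi

variable {G : Type*} [Group G] [Fintype G]

theorem psi_congr {π ρ : Set ℕ} (h : ∀ p, p.Prime → p ∣ Nat.card G → (p ∈ π ↔ p ∈ ρ)) :
    psi π G = psi ρ G := by
  simp only [psi, piPart_congr h]

theorem psi_coe (σ : Finset ℕ) : psi (σ : Set ℕ) G = ∑ x : G, primePart σ (orderOf x) := by
  simp only [psi, orderOf_piPart_coe]

theorem psi_coe_congr_mulEquiv {H : Type*} [Group H] [Fintype H] (σ : Finset ℕ) (e : G ≃* H) :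
    psi (σ : Set ℕ) G = psi (σ : Set ℕ) H := by
  rw [psi_coe, psi_coe]
  exact Fintype.sum_equiv e.toEquiv _ _ fun x => by
    rw [MulEquiv.toEquiv_eq_coe, MulEquiv.coe_toEquiv, e.orderOf_eq]

theorem sum_comp_orderOf_of_isCyclic [IsCyclic G] (f : ℕ → ℚ) :
    ∑ x : G, f (orderOf x) = ∑ d ∈ (Nat.card G).divisors, d.totient * f d := by
  classical
  have hmaps : ∀ x ∈ (univ : Finset G), orderOf x ∈ (Nat.card G).divisors := fun x _ =>
    Nat.mem_divisors.2 ⟨orderOf_dvd_natCard x, Nat.card_pos.ne'⟩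
  rw [← sum_fiberwise_of_maps_to' hmaps]
  refine sum_congr rfl fun d hd => ?_
  rw [sum_const, nsmul_eq_mul, IsCyclic.card_orderOf_eq_totient
    (Nat.card_eq_fintype_card (α := G) ▸ Nat.dvd_of_mem_divisors hd)]

theorem psi_of_isCyclic [IsCyclic G] (σ : Finset ℕ) :
    (psi (σ : Set ℕ) G : ℚ) = Nat.card G * meanPrimePart σ (Nat.card G) := by
  rw [psi_coe, Nat.cast_sum, sum_comp_orderOf_of_isCyclic fun d => (primePart σ d : ℚ),
    sum_totient_mul_primePart]

theorem sum_orderOf_of_isCyclic [IsCyclic G] {p a : ℕ} (hp : p.Prime) (hG : Nat.card G = p ^ a) :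
    ∑ x : G, (orderOf x : ℚ) = (p : ℚ) ^ a * meanOrder p a := by
  rw [sum_comp_orderOf_of_isCyclic fun d => (d : ℚ), hG, Nat.sum_divisors_prime_pow hp,
    pow_mul_meanOrder hp.ne_zero]
  simp only [Nat.cast_pow]

end Psi

section Centralizer

variable {G : Type*} [Group G] [Finite G] {p : ℕ} [Fact p.Prime]

theorem normalizer_le_centralizer_of_mem_center (P : Sylow p G) [IsCyclic P] {y : G}
    (hy : y ∈ Subgroup.center G) (hyP : y ∈ P) (hy1 : y ≠ 1) :
    Subgroup.normalizer P ≤ Subgroup.centralizer (P : Set G) := by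
  -- Otherwise `y` lies in the commutator subgroup, so the transfer `G → P`, which sends the central
  -- element `y` to `y ^ [G : P]`, kills it; but `[G : P]` is prime to the order of `y`.
  refine P.normalizer_le_centralizer_or_le_commutator.resolve_right fun hcomm => hy1 ?_
  let _ : CommGroup P := IsCyclic.commGroup
  let transfer : G →* P := MonoidHom.transfer (MonoidHom.id P)
  have hker : transfer y = 1 := Abelianization.commutator_subset_ker transfer (hcomm hyP)
  have hconj : ∀ (k : ℕ) (g : G), g⁻¹ * y ^ k * g ∈ (P : Subgroup G) →
      g⁻¹ * y ^ k * g = y ^ k := fun k g _ => by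
    rw [mul_assoc, ← Subgroup.mem_center_iff.1 (pow_mem hy k) g, inv_mul_cancel_left]
  have hindex : y ^ (P : Subgroup G).index = 1 :=
    congrArg Subtype.val ((MonoidHom.transfer_eq_pow (MonoidHom.id P) y hconj).symm.trans hker)
  have hcard : orderOf y ∣ Nat.card P := by
    rw [← Subgroup.orderOf_mk y hyP]
    exact orderOf_dvd_natCard _
  exact orderOf_eq_one_iff.1
    (Nat.eq_one_of_dvd_coprimes P.card_coprime_index hcard (orderOf_dvd_of_pow_eq_one hindex))

theorem exists_complement_sylow (P : Sylow p G)
    (hP : Subgroup.normalizer P ≤ Subgroup.centralizer (P : Set G)) :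
    ∃ K : Subgroup G, Nat.card K * Nat.card P = Nat.card G ∧ ∀ z : G, ¬ p ∣ orderOf z → z ∈ K := by
  refine ⟨(MonoidHom.transferSylow P hP).ker,
    (MonoidHom.ker_transferSylow_isComplement' P hP).card_mul_card, fun z hz => ?_⟩
  have hdvd := orderOf_map_dvd (MonoidHom.transferSylow P hP) z
  obtain ⟨k, hk⟩ := IsPGroup.iff_orderOf.1 P.isPGroup' (MonoidHom.transferSylow P hP z)
  rw [MonoidHom.mem_ker, ← orderOf_eq_one_iff]
  cases k with
  | zero => rw [hk, pow_zero]
  | succ k => exact absurd ((dvd_pow_self p k.succ_ne_zero).trans (hk ▸ hdvd)) hz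

theorem exists_complement_sylow_centralizer (P : Sylow p G) [IsCyclic P] {y : G} (hyP : y ∈ P)
    (hy1 : y ≠ 1) :
    ∃ K : Subgroup G, Nat.card K * Nat.card P = Nat.card (Subgroup.centralizer {y}) ∧
      ∀ z ∈ Subgroup.centralizer {y}, ¬ p ∣ orderOf z → z ∈ K := by
  let C := Subgroup.centralizer {y}
  have hPC : (P : Subgroup G) ≤ C := fun u hu => by
    let _ : CommGroup P := IsCyclic.commGroup
    exact Subgroup.mem_centralizer_singleton_iff.2
      (congrArg Subtype.val (mul_comm (⟨u, hu⟩ : P) ⟨y, hyP⟩))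
  let Q : Sylow p C := P.subtype hPC
  let e : Q ≃* P := Subgroup.subgroupOfEquivOfLe hPC
  have : IsCyclic Q := isCyclic_of_surjective _ e.symm.surjective
  have hycenter : (⟨y, hPC hyP⟩ : C) ∈ Subgroup.center C := Subgroup.mem_center_iff.2 fun g =>
    Subtype.ext (Subgroup.mem_centralizer_singleton_iff.1 g.2)
  obtain ⟨K, hcard, hK⟩ := exists_complement_sylow Q
    (normalizer_le_centralizer_of_mem_center Q hycenter hyP fun h => hy1 (congrArg Subtype.val h))
  refine ⟨K.map C.subtype, ?_, fun z hzC hz => ?_⟩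
  · rw [Subgroup.card_subtype, ← Nat.card_congr e.toEquiv, hcard]
  · exact ⟨⟨z, hzC⟩, hK _ (by rwa [Subgroup.orderOf_mk]), rfl⟩

end Centralizer

section Fibre

variable {G : Type*} [Group G] {p : ℕ} {τ : Finset ℕ}

theorem IsPiDecomposition.primePart_orderOf_eq [Finite G] {x y z : G}
    (h : IsPiDecomposition {p} x y z) (hpτ : p ∉ τ) :
    primePart τ (orderOf x) = primePart τ (orderOf z) := by
  have hy : primePart τ (orderOf y) = 1 := primePart_eq_one fun q hq hqp hqy =>
    hpτ (h.2.2.1.2 q hqp hqy ▸ hq)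
  rw [h.orderOf_eq_mul, primePart_mul τ (orderOf_pos y).ne' (orderOf_pos z).ne', hy, one_mul]

variable [Fintype G] [DecidableEq G]

theorem sum_piPart_eq_le_psi (hp : p.Prime) (hpτ : p ∉ τ) {y : G} {K : Subgroup G}
    [Fintype K] (hK : ∀ z ∈ Subgroup.centralizer {y}, ¬ p ∣ orderOf z → z ∈ K) :
    ∑ x : G with piPart {p} x = y, primePart τ (orderOf x) ≤ psi (τ : Set ℕ) K := by
  classical
  have hdecomp : ∀ z, piPart {p} (y * z) = y → IsPiDecomposition {p} (y * z) y z := fun z hz => by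
    obtain ⟨w, hw⟩ := piPart_spec {p} (y * z)
    rw [hz] at hw
    rwa [← mul_left_cancel hw.1] at hw
  have hmem : ∀ z, piPart {p} (y * z) = y → z ∈ K := fun z hz =>
    have h := hdecomp z hz
    hK z (Subgroup.mem_centralizer_singleton_iff.2 h.2.1.symm.eq)
      fun hpz => (h.2.2.2.2 p hp hpz).2 rfl
  calc ∑ x : G with piPart {p} x = y, primePart τ (orderOf x)
      = ∑ z : G with piPart {p} (y * z) = y, primePart τ (orderOf (y * z)) := by
        rw [sum_filter, sum_filter]
        exact (Equiv.sum_comp (Equiv.mulLeft y) _).symm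
    _ = ∑ z : G with piPart {p} (y * z) = y, primePart τ (orderOf z) :=
        sum_congr rfl fun z hz => (hdecomp z (mem_filter.1 hz).2).primePart_orderOf_eq hpτ
    _ ≤ ∑ z : G with z ∈ K, primePart τ (orderOf z) :=
        sum_le_sum_of_subset (monotone_filter_right univ fun z _ hz => hmem z hz)
    _ = ∑ k : K, primePart τ (orderOf (k : G)) := sum_subtype _ (by simp) _
    _ = psi (τ : Set ℕ) K := by simp only [psi_coe, Subgroup.orderOf_coe]

theorem psi_insert_eq (hpτ : p ∉ τ) {S : Finset G} (hS : ∀ x : G, piPart {p} x ∈ S) :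
    (psi (insert p τ : Finset ℕ) G : ℚ) = psi (τ : Set ℕ) G +
      ∑ y ∈ S,
        ((orderOf y : ℚ) - 1) * ∑ x : G with piPart {p} x = y, (primePart τ (orderOf x) : ℚ) := by
  have hsplit : ∀ x : G, (primePart (insert p τ) (orderOf x) : ℚ) = primePart τ (orderOf x) +
      ((orderOf (piPart {p} x) : ℚ) - 1) * primePart τ (orderOf x) := fun x => by
    rw [primePart_insert hpτ, orderOf_piPart_singleton]
    push_cast
    ring
  simp only [psi_coe, Nat.cast_sum, hsplit, sum_add_distrib, mul_sum]
  refine congrArg _ ((sum_fiberwise_of_maps_to (g := piPart {p})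
    (fun x _ => hS x) _).symm.trans ?_)
  exact sum_congr rfl fun y _ => sum_congr rfl fun x hx => by rw [(mem_filter.1 hx).2]

end Fibre

section ConjugacyClasses

variable {G : Type*} [Group G] [Fintype G] (P : Subgroup G) [DecidablePred (· ∈ P)]

theorem card_centralizer_le_card_conj_mem {y g₀ : G} (h : g₀⁻¹ * y * g₀ ∈ P) :
    Nat.card (Subgroup.centralizer {y}) ≤ #{g : G | g⁻¹ * y * g ∈ P} := by
  classical
  rw [Nat.card_eq_fintype_card, ← card_univ]
  refine card_le_card_of_injOn (fun c => (c : G) * g₀) (fun c _ => ?_)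
    fun a _ b _ hab => Subtype.ext (mul_right_cancel hab)
  have hc : c * y = y * c := Subgroup.mem_centralizer_singleton_iff.1 c.2
  have hconj : (c * g₀)⁻¹ * y * (c * g₀) = g₀⁻¹ * y * g₀ := by
    rw [mul_inv_rev, mul_assoc _ y, ← mul_assoc y, ← hc]
    group
  exact mem_filter.2 ⟨mem_univ _, hconj ▸ h⟩

theorem card_centralizer_lt_card_conj_mem {u : G} (hu : Subgroup.zpowers u = P)
    (h : ¬ Subgroup.normalizer (P : Set G) ≤ Subgroup.centralizer (P : Set G)) :
    Nat.card (Subgroup.centralizer {u}) < #{g : G | g⁻¹ * u * g ∈ P} := by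
  classical
  obtain ⟨g, hgN, hgC⟩ := SetLike.not_le_iff_exists.1 h
  have huP : u ∈ P := hu ▸ Subgroup.mem_zpowers u
  rw [← hu, Subgroup.zpowers_eq_closure, Subgroup.centralizer_closure] at hgC
  have hcard : Nat.card (Subgroup.centralizer {u}) = #{g : G | g ∈ Subgroup.centralizer {u}} := by
    rw [Nat.card_eq_fintype_card, Fintype.card_subtype]
  rw [hcard]
  refine card_lt_card ((ssubset_iff_of_subset fun c hc => ?_).2 ⟨g, ?_, ?_⟩)
  · have hcu := Subgroup.mem_centralizer_singleton_iff.1 (mem_filter.1 hc).2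
    refine mem_filter.2 ⟨mem_univ _, ?_⟩
    rwa [mul_assoc, ← hcu, inv_mul_cancel_left]
  · simpa using (Subgroup.mem_normalizer_iff.1 (inv_mem hgN) u).1 huP
  · exact fun hg => hgC (mem_filter.1 hg).2

theorem sum_mul_card_conj_mem {f : G → ℚ} (hf : ∀ g y, f (g * y * g⁻¹) = f y) :
    ∑ y : G, f y * #{g : G | g⁻¹ * y * g ∈ P} = Nat.card G * ∑ u : P, f u := by
  have hconj : ∀ g : G, (∑ y : G, if g⁻¹ * y * g ∈ P then f y else 0) = ∑ u : P, f u := by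
    intro g
    have hcancel : ∀ y : G, g⁻¹ * (g * y * g⁻¹) * g = y := fun y => by group
    rw [← (MulAut.conj g).toEquiv.sum_comp]
    simp only [MulEquiv.toEquiv_eq_coe, MulEquiv.coe_toEquiv, MulAut.conj_apply, hf, hcancel]
    rw [← sum_filter]
    exact sum_subtype _ (by simp) f
  calc ∑ y : G, f y * #{g : G | g⁻¹ * y * g ∈ P}
      = ∑ y : G, ∑ g : G, if g⁻¹ * y * g ∈ P then f y else 0 := by
        simp only [← sum_filter, sum_const, nsmul_eq_mul, mul_comm]
    _ = ∑ g : G, ∑ y : G, if g⁻¹ * y * g ∈ P then f y else 0 := sum_comm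
    _ = Nat.card G * ∑ u : P, f u := by
        simp only [hconj, sum_const, card_univ, nsmul_eq_mul, Nat.card_eq_fintype_card]

theorem sum_mul_card_centralizer_le {f : G → ℚ} (hf : ∀ g y, f (g * y * g⁻¹) = f y)
    (hf0 : ∀ y, 0 ≤ f y) {S : Finset G} (hS : ∀ y ∈ S, ∃ g, g⁻¹ * y * g ∈ P) :
    ∑ y ∈ S, f y * Nat.card (Subgroup.centralizer {y}) ≤ Nat.card G * ∑ u : P, f u := by
  rw [← sum_mul_card_conj_mem P hf]
  refine (sum_le_sum fun y hy => ?_).trans (sum_le_univ_sum_of_nonneg fun y =>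
    mul_nonneg (hf0 y) (Nat.cast_nonneg _))
  obtain ⟨g, hg⟩ := hS y hy
  exact mul_le_mul_of_nonneg_left
    (Nat.cast_le.2 (card_centralizer_le_card_conj_mem P hg)) (hf0 y)

theorem sum_mul_card_centralizer_lt {f : G → ℚ} (hf : ∀ g y, f (g * y * g⁻¹) = f y)
    (hf0 : ∀ y, 0 ≤ f y) {S : Finset G} (hS : ∀ y ∈ S, ∃ g, g⁻¹ * y * g ∈ P) {u : G}
    (huS : u ∈ S) (hu : Subgroup.zpowers u = P) (hfu : 0 < f u)
    (hP : ¬ Subgroup.normalizer (P : Set G) ≤ Subgroup.centralizer (P : Set G)) :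
    ∑ y ∈ S, f y * Nat.card (Subgroup.centralizer {y}) < Nat.card G * ∑ u : P, f u := by
  rw [← sum_mul_card_conj_mem P hf]
  refine (sum_lt_sum (fun y hy => ?_) ⟨u, huS, ?_⟩).trans_le
    (sum_le_univ_sum_of_nonneg fun y => mul_nonneg (hf0 y) (Nat.cast_nonneg _))
  · obtain ⟨g, hg⟩ := hS y hy
    exact mul_le_mul_of_nonneg_left
      (Nat.cast_le.2 (card_centralizer_le_card_conj_mem P hg)) (hf0 y)
  · exact mul_lt_mul_of_pos_left (Nat.cast_lt.2 (card_centralizer_lt_card_conj_mem P hu hP)) hfu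

end ConjugacyClasses

section SylowOrders

variable {G : Type*} [Group G] [Finite G] {p : ℕ} [Fact p.Prime]

theorem orderOf_mul_mul_inv {G : Type*} [Group G] (g y : G) : orderOf (g * y * g⁻¹) = orderOf y :=
  (MulAut.conj g).orderOf_eq y

theorem exists_conj_mem_sylow (P : Sylow p G) {y : G} (hy : IsPGroup p (Subgroup.zpowers y)) :
    ∃ g : G, g⁻¹ * y * g ∈ P := by
  obtain ⟨Q, hQ⟩ := hy.exists_le_sylow
  obtain ⟨g, rfl⟩ := MulAction.exists_smul_eq G P Q
  have hyQ := hQ (Subgroup.mem_zpowers y)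
  rw [Sylow.coe_subgroup_smul, Subgroup.mem_pointwise_smul_iff_inv_smul_mem, ← map_inv,
    MulAut.smul_def, MulAut.conj_apply, inv_inv] at hyQ
  exact ⟨g, hyQ⟩

theorem sum_orderOf_sub_one_sylow (P : Sylow p G) [IsCyclic P] [Fintype P] :
    ∑ u : P, ((orderOf (u : G) : ℚ) - 1) =
      Nat.card P * (meanOrder p ((Nat.card G).factorization p) - 1) := by
  have hcard : (Nat.card P : ℚ) = (p : ℚ) ^ (Nat.card G).factorization p := by
    exact_mod_cast P.card_eq_multiplicity
  simp only [Subgroup.orderOf_coe, sum_sub_distrib,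
    sum_orderOf_of_isCyclic Fact.out P.card_eq_multiplicity, sum_const, card_univ,
    ← Nat.card_eq_fintype_card, nsmul_eq_mul, hcard]
  ring

end SylowOrders

section Insert

variable {G : Type*} [Group G] [Fintype G] {p : ℕ} [Fact p.Prime] {τ : Finset ℕ}

theorem sum_piPart_eq_mul_card_sylow_le [DecidableEq G] (hpτ : p ∉ τ)
    (hτ : ∀ (K : Subgroup G) [Fintype K],
      (psi (τ : Set ℕ) K : ℚ) ≤ Nat.card K * meanPrimePart τ (Nat.card K))
    (P : Sylow p G) [IsCyclic P] {y : G} (hyP : y ∈ P) (hy1 : y ≠ 1) :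
    (∑ x : G with piPart {p} x = y, (primePart τ (orderOf x) : ℚ)) * Nat.card P ≤
      Nat.card (Subgroup.centralizer {y}) * meanPrimePart τ (Nat.card G) := by
  classical
  obtain ⟨K, hcard, hK⟩ := exists_complement_sylow_centralizer P hyP hy1
  calc (∑ x : G with piPart {p} x = y, (primePart τ (orderOf x) : ℚ)) * Nat.card P
      ≤ psi (τ : Set ℕ) K * Nat.card P := by
        gcongr
        exact_mod_cast sum_piPart_eq_le_psi Fact.out hpτ hK
    _ ≤ Nat.card K * meanPrimePart τ (Nat.card G) * Nat.card P := by
        gcongr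
        exact (hτ K).trans (mul_le_mul_of_nonneg_left (meanPrimePart_le_of_dvd τ Nat.card_pos.ne'
          (Subgroup.card_subgroup_dvd_card K)) (Nat.cast_nonneg _))
    _ = Nat.card (Subgroup.centralizer {y}) * meanPrimePart τ (Nat.card G) := by
        rw [← hcard, Nat.cast_mul, mul_right_comm]

theorem psi_insert_le_add_sum_centralizer (hpτ : p ∉ τ)
    (hτ : ∀ (K : Subgroup G) [Fintype K],
      (psi (τ : Set ℕ) K : ℚ) ≤ Nat.card K * meanPrimePart τ (Nat.card K))
    (P : Sylow p G) [IsCyclic P] {S : Finset G}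
    (hS : ∀ y, y ∈ S ↔ IsPGroup p (Subgroup.zpowers y)) :
    (psi (insert p τ : Finset ℕ) G : ℚ) ≤ psi (τ : Set ℕ) G +
      meanPrimePart τ (Nat.card G) / Nat.card P *
        ∑ y ∈ S, ((orderOf y : ℚ) - 1) * Nat.card (Subgroup.centralizer {y}) := by
  classical
  have hP : (0 : ℚ) < Nat.card P := Nat.cast_pos.2 Nat.card_pos
  rw [psi_insert_eq hpτ fun x => (hS _).2 (isPGroup_zpowers_piPart p x), mul_sum]
  refine add_le_add_right (sum_le_sum fun y hy => ?_) _
  obtain ⟨Q, hQ⟩ := ((hS y).1 hy).exists_le_sylow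
  have : IsCyclic Q := isCyclic_of_surjective _ (P.equiv Q).surjective
  rcases eq_or_ne y 1 with rfl | hy1
  · simp
  · have hfibre := sum_piPart_eq_mul_card_sylow_le hpτ hτ Q (hQ (Subgroup.mem_zpowers y)) hy1
    rw [← Nat.card_congr (P.equiv Q).toEquiv, ← le_div_iff₀ hP] at hfibre
    have ho : (1 : ℚ) ≤ orderOf y := Nat.one_le_cast.2 (orderOf_pos y)
    refine (mul_le_mul_of_nonneg_left hfibre (sub_nonneg.2 ho)).trans_eq ?_
    ring

theorem psi_le_of_forall_subgroup
    (hτ : ∀ (K : Subgroup G) [Fintype K],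
      (psi (τ : Set ℕ) K : ℚ) ≤ Nat.card K * meanPrimePart τ (Nat.card K)) :
    (psi (τ : Set ℕ) G : ℚ) ≤ Nat.card G * meanPrimePart τ (Nat.card G) := by
  classical
  rw [← psi_coe_congr_mulEquiv τ Subgroup.topEquiv, ← Subgroup.card_top]
  exact hτ ⊤

theorem psi_insert_sub_le (hpτ : p ∉ τ)
    (hτ : ∀ (K : Subgroup G) [Fintype K],
      (psi (τ : Set ℕ) K : ℚ) ≤ Nat.card K * meanPrimePart τ (Nat.card K))
    (P : Sylow p G) [IsCyclic P] [Fintype P] {S : Finset G}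
    (hS : ∀ y, y ∈ S ↔ IsPGroup p (Subgroup.zpowers y)) :
    (psi (insert p τ : Finset ℕ) G : ℚ) - Nat.card G * meanPrimePart (insert p τ) (Nat.card G) ≤
      meanPrimePart τ (Nat.card G) / Nat.card P *
        (∑ y ∈ S, ((orderOf y : ℚ) - 1) * Nat.card (Subgroup.centralizer {y}) -
          Nat.card G * ∑ u : P, ((orderOf (u : G) : ℚ) - 1)) := by
  have hP : (Nat.card P : ℚ) ≠ 0 := Nat.cast_ne_zero.2 Nat.card_pos.ne'
  rw [sum_orderOf_sub_one_sylow, meanPrimePart_insert hpτ, sub_le_iff_le_add]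
  refine (psi_insert_le_add_sum_centralizer hpτ hτ P hS).trans
    ((add_le_add_left (psi_le_of_forall_subgroup hτ) _).trans_eq ?_)
  field

theorem psi_insert_le_of_isCyclic_sylow (hpτ : p ∉ τ)
    (hτ : ∀ (K : Subgroup G) [Fintype K],
      (psi (τ : Set ℕ) K : ℚ) ≤ Nat.card K * meanPrimePart τ (Nat.card K))
    (P : Sylow p G) [IsCyclic P] :
    (psi (insert p τ : Finset ℕ) G : ℚ) ≤
      Nat.card G * meanPrimePart (insert p τ) (Nat.card G) := by
  classical
  have hM := meanPrimePart_pos τ (Nat.card G)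
  let S : Finset G := {y | IsPGroup p (Subgroup.zpowers y)}
  have hS : ∀ y, y ∈ S ↔ IsPGroup p (Subgroup.zpowers y) := fun y => by simp [S]
  have hsum := sum_mul_card_centralizer_le (P : Subgroup G) (f := fun y => (orderOf y : ℚ) - 1)
    (fun g y => by rw [orderOf_mul_mul_inv])
    (fun y => sub_nonneg.2 (Nat.one_le_cast.2 (orderOf_pos y)))
    (fun y hy => exists_conj_mem_sylow P ((hS y).1 hy))
  exact sub_nonpos.1 ((psi_insert_sub_le hpτ hτ P hS).trans
    (mul_nonpos_of_nonneg_of_nonpos (by positivity) (sub_nonpos.2 hsum)))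

theorem psi_insert_lt_of_not_normalizer_le_centralizer (hpτ : p ∉ τ)
    (hτ : ∀ (K : Subgroup G) [Fintype K],
      (psi (τ : Set ℕ) K : ℚ) ≤ Nat.card K * meanPrimePart τ (Nat.card K))
    (P : Sylow p G) [IsCyclic P]
    (hP : ¬ Subgroup.normalizer P ≤ Subgroup.centralizer (P : Set G)) :
    (psi (insert p τ : Finset ℕ) G : ℚ) <
      Nat.card G * meanPrimePart (insert p τ) (Nat.card G) := by
  classical
  have hM := meanPrimePart_pos τ (Nat.card G)
  have hcard : (0 : ℚ) < Nat.card P := Nat.cast_pos.2 Nat.card_pos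
  let S : Finset G := {y | IsPGroup p (Subgroup.zpowers y)}
  have hS : ∀ y, y ∈ S ↔ IsPGroup p (Subgroup.zpowers y) := fun y => by simp [S]
  obtain ⟨u, hu⟩ := (Subgroup.isCyclic_iff_exists_zpowers_eq_top (P : Subgroup G)).1 ‹IsCyclic P›
  have hu1 : u ≠ 1 := by
    rintro rfl
    refine hP fun g _ => Subgroup.mem_centralizer_iff.2 fun v hv => ?_
    have hv1 : v ∈ Subgroup.zpowers (1 : G) := hu ▸ hv
    rw [Subgroup.zpowers_one_eq_bot, Subgroup.mem_bot] at hv1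
    rw [hv1, one_mul, mul_one]
  have ho : 1 < orderOf u :=
    lt_of_le_of_ne (orderOf_pos u) fun h => hu1 (orderOf_eq_one_iff.1 h.symm)
  have hsum := sum_mul_card_centralizer_lt (P : Subgroup G) (f := fun y => (orderOf y : ℚ) - 1)
    (fun g y => by rw [orderOf_mul_mul_inv])
    (fun y => sub_nonneg.2 (Nat.one_le_cast.2 (orderOf_pos y)))
    (fun y hy => exists_conj_mem_sylow P ((hS y).1 hy))
    ((hS u).2 (hu ▸ P.isPGroup')) hu (sub_pos.2 (Nat.one_lt_cast.2 ho)) hP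
  exact sub_neg.1 ((psi_insert_sub_le hpτ hτ P hS).trans_lt
    (mul_neg_of_pos_of_neg (by positivity) (sub_neg.2 hsum)))

theorem psi_insert_lt_of_not_isCyclic_sylow (hpτ : p ∉ τ)
    (hτG : (psi (τ : Set ℕ) G : ℚ) ≤ Nat.card G * meanPrimePart τ (Nat.card G))
    (P : Sylow p G) (hP : ¬ IsCyclic P) :
    (psi (insert p τ : Finset ℕ) G : ℚ) <
      Nat.card G * meanPrimePart (insert p τ) (Nat.card G) := by
  have hp : p.Prime := Fact.out
  have hlt : ∀ x : G, (orderOf x).factorization p < (Nat.card G).factorization p := fun x =>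
    (factorization_orderOf_le p x).lt_of_ne fun h =>
      hP (isCyclic_sylow_of_factorization_orderOf_eq P h)
  obtain ⟨b, hb⟩ := Nat.exists_eq_succ_of_ne_zero (hlt 1).ne_bot
  have hM : 0 < Nat.card G * meanPrimePart τ (Nat.card G) :=
    mul_pos (Nat.cast_pos.2 Nat.card_pos) (meanPrimePart_pos τ _)
  have hle : psi (insert p τ : Finset ℕ) G ≤ p ^ b * psi (τ : Set ℕ) G := by
    simp only [psi_coe, mul_sum, primePart_insert hpτ]
    exact sum_le_sum fun x _ => Nat.mul_le_mul_right _
      (Nat.pow_le_pow_right hp.pos (Nat.lt_succ_iff.1 (hb ▸ hlt x)))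
  calc (psi (insert p τ : Finset ℕ) G : ℚ)
      ≤ (p : ℚ) ^ b * psi (τ : Set ℕ) G := by exact_mod_cast hle
    _ ≤ (p : ℚ) ^ b * (Nat.card G * meanPrimePart τ (Nat.card G)) := by gcongr
    _ < meanOrder p (b + 1) * (Nat.card G * meanPrimePart τ (Nat.card G)) :=
        mul_lt_mul_of_pos_right (pow_lt_meanOrder_succ hp b) hM
    _ = Nat.card G * meanPrimePart (insert p τ) (Nat.card G) := by
        rw [meanPrimePart_insert hpτ, hb, mul_left_comm]

end Insert

section PsiLe

theorem psi_le.{u} (σ : Finset ℕ) (G : Type u) [Group G] [Fintype G] :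
    (psi (σ : Set ℕ) G : ℚ) ≤ Nat.card G * meanPrimePart σ (Nat.card G) := by
  induction σ using Finset.induction_on generalizing G with
  | empty =>
    rw [psi_coe]
    simp [primePart, meanPrimePart, Nat.card_eq_fintype_card]
  | insert p τ hpτ ih =>
    by_cases hp : p.Prime
    · have := Fact.mk hp
      by_cases hP : IsCyclic (default : Sylow p G)
      · exact psi_insert_le_of_isCyclic_sylow hpτ (fun K _ => ih K) default
      · exact (psi_insert_lt_of_not_isCyclic_sylow hpτ (ih G) default hP).le
    · have hfac : ∀ m : ℕ, m.factorization p = 0 := fun m =>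
        Nat.factorization_eq_zero_of_not_prime m hp
      simp only [psi_coe, primePart_insert hpτ, meanPrimePart_insert hpτ, hfac, pow_zero,
        meanOrder_zero, one_mul] at ih ⊢
      exact ih G

variable {G : Type*} [Group G] [Fintype G] {p : ℕ} [Fact p.Prime]

theorem sylow_isCyclic_and_central_of_psi_eq {σ : Finset ℕ} (hpσ : p ∈ σ)
    (h : (psi (σ : Set ℕ) G : ℚ) = Nat.card G * meanPrimePart σ (Nat.card G)) (P : Sylow p G) :
    IsCyclic P ∧ Subgroup.normalizer P ≤ Subgroup.centralizer (P : Set G) := by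
  have hp := notMem_erase p σ
  rw [← insert_erase hpσ] at h
  have hcyc : IsCyclic P := by
    by_contra hP
    exact (psi_insert_lt_of_not_isCyclic_sylow hp (psi_le _ G) P hP).ne h
  refine ⟨hcyc, ?_⟩
  by_contra hP
  exact (psi_insert_lt_of_not_normalizer_le_centralizer hp
    (fun K _ => psi_le _ K) P hP).ne h

theorem psi_eq_card_mul_meanPrimePart_of_psi_eq {C : Type*} [Group C] [Fintype C] [IsCyclic C]
    {π : Set ℕ} (hC : Nat.card C = Nat.card G) (h : psi π G = psi π C) {σ : Finset ℕ}
    (hσ : ∀ q, q.Prime → q ∣ Nat.card G → (q ∈ π ↔ q ∈ σ)) :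
    (psi (σ : Set ℕ) G : ℚ) = Nat.card G * meanPrimePart σ (Nat.card G) := by
  rw [← hC, ← psi_of_isCyclic, ← psi_congr (ρ := σ) hσ, h, psi_congr (ρ := σ) (hC ▸ hσ)]

theorem sylow_isCyclic_and_central_of_psi_eq_psi_cyclic {C : Type*} [Group C] [Fintype C]
    [IsCyclic C] {π : Set ℕ} (hC : Nat.card C = Nat.card G) (h : psi π G = psi π C) (hpπ : p ∈ π)
    (hpG : p ∣ Nat.card G) (P : Sylow p G) :
    IsCyclic P ∧ Subgroup.normalizer P ≤ Subgroup.centralizer (P : Set G) := by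
  classical
  let σ : Finset ℕ := {q ∈ (Nat.card G).primeFactors | q ∈ π}
  have hσ : ∀ q, q.Prime → q ∣ Nat.card G → (q ∈ π ↔ q ∈ σ) := fun q hq hqG => by
    simp only [σ, mem_filter, Nat.mem_primeFactors_of_ne_zero Nat.card_pos.ne', hq, hqG, true_and]
  exact sylow_isCyclic_and_central_of_psi_eq ((hσ p Fact.out hpG).1 hpπ)
    (psi_eq_card_mul_meanPrimePart_of_psi_eq hC h hσ) P

end PsiLe

theorem isCyclic_of_forall_sylow {G : Type*} [Group G] [Finite G]
    (h : ∀ p : ℕ, p.Prime → p ∣ Nat.card G → ∀ P : Sylow p G,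
      IsCyclic P ∧ Subgroup.normalizer P ≤ Subgroup.centralizer (P : Set G)) : IsCyclic G := by
  have hZ : IsZGroup G := ⟨fun p hp P => by
    have := Fact.mk hp
    by_cases hpG : p ∣ Nat.card G
    · exact (h p hp hpG P).1
    · have hP : Nat.card P = 1 := by
        rw [P.card_eq_multiplicity, Nat.factorization_eq_zero_of_not_dvd hpG, pow_zero]
      have := (Nat.card_eq_one_iff_unique.1 hP).1
      infer_instance⟩
  -- The kernel of the transfer into a Sylow `p`-subgroup has order prime to `p` and contains the
  -- commutator subgroup.
  have hcomm : commutator G = ⊥ := by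
    rw [← Subgroup.card_eq_one]
    by_contra hne
    obtain ⟨p, hp, hpc⟩ := Nat.exists_prime_and_dvd hne
    have := Fact.mk hp
    obtain ⟨hcyc, hN⟩ := h p hp (hpc.trans (Subgroup.card_subgroup_dvd_card _)) default
    let _ : CommGroup (default : Sylow p G) := IsCyclic.commGroup
    exact MonoidHom.not_dvd_card_ker_transferSylow default hN
      (hpc.trans (Subgroup.card_dvd_of_le (Abelianization.commutator_subset_ker _)))
  refine isCyclic_of_injective (Abelianization.of (G := G)) ?_
  rw [← MonoidHom.ker_eq_bot_iff, Abelianization.ker_of, hcomm]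

theorem corollary3p2_general {G : Type*} [Group G] [Fintype G] (n : ℕ) [NeZero n]
    (hn : Fintype.card G = n)
    (h : ∀ p : ℕ, p.Prime → p ∣ n →
      ∃ π : Set ℕ, p ∈ π ∧ psi π G = psi π (Multiplicative (ZMod n))) :
    Nonempty (G ≃* Multiplicative (ZMod n)) := by
  have hcard : Nat.card (Multiplicative (ZMod n)) = Nat.card G := by
    simp [Nat.card_eq_fintype_card, hn]
  have : IsCyclic G := isCyclic_of_forall_sylow fun p hp hpG P => by
    have := Fact.mk hp
    obtain ⟨π, hpπ, hπ⟩ := h p hp (by rwa [← hn, ← Nat.card_eq_fintype_card])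
    exact sylow_isCyclic_and_central_of_psi_eq_psi_cyclic hcard hπ hpπ hpG P
  exact ⟨mulEquivOfCyclicCardEq hcard.symm⟩

theorem corollary3p2 {G : Type*} [Group G] [Fintype G] (n : ℕ) [NeZero n]
    (hn : Fintype.card G = n) (π : Set ℕ) (hπ : ∀ p ∈ π, p.Prime ∧ p ∣ n)
    (h : psi π G = psi π (Multiplicative (ZMod n)))
    (h' : psi (piCompl π) G = psi (piCompl π) (Multiplicative (ZMod n))) :
    Nonempty (G ≃* Multiplicative (ZMod n)) :=
  corollary3p2_general n hn fun p hp _ => (Classical.em (p ∈ π)).elim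
    (fun hpπ => ⟨π, hpπ, h⟩) (fun hpπ => ⟨piCompl π, ⟨hp, hpπ⟩, h'⟩)
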